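/- **Setting.** There are $M\ge 1$ sources. Source $m$ is a Markov chain on a nonempty finite set $\mathcal X^m$ with an irreducible and aperiodic stochastic transition matrix $\mathbf Q^m$. In every slot the agent chooses an action $a\in\mathcal A=\{0,1,\dots,M\}$: $a=0$ means staying silent, and $a=m\neq 0$ means sampling source $m$ and transmitting the sample over a channel with success probability $p_s\in(0,1]$. The state of the system is $s=(s(m))_m$ with $s(m)=(i,j)\in\mathcal X^m\times\mathcal X^m$, where $i$ is the current state of source $m$ and $j$ is its most recent reconstruction known to the agent. The transition probabilities are $P(s'|s,a)=\prod_m P^m(s'(m)|s(m),a)$, where, from $s(m)=(i,j)$, the source moves to $k$ with probability $\mathbf Q^m_{i,k}$ and, independently, the reconstruction becomes $i$ with probability $p_s$ and stays $j$ with probability $1-p_s$ if $a=m$, and stays $j$ if $a\ne m$. Let $\delta^m:\mathcal X^m\times\mathcal X^m\to\mathbb R_{\ge0}$ and let $\omega_m$ be real weights. The actuation cost is $c(s,a,s')=\sum_m\omega_m\,\delta^m(x_m,j'_m)$ with $s(m)=(i_m,j_m)$ and $s'(m)=(i'_m,j'_m)$, where $x_m=i_m$ in the zero-delay case and $x_m=i'_m$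 in the one-delay case. The transmission cost is $f(s,a)=\mathbf 1(a\neq0)$. For a history-dependent randomized policy $\pi\in\Pi$ and an initial state $s$, let $C_s(\pi)$, $F_s(\pi)$ and $\mathcal L^\lambda_s(\pi)$ be the limsup average expected costs ($\limsup_{T\to\infty}\frac1T\sum_{t=1}^T\mathbb E^\pi[\,\cdot\,|S_1=s]$) for the one-step costs $c$, $f$ and $c+\lambda f$. A policy is *$\lambda$-optimal* if it minimizes $\mathcal L^\lambda_s$ over $\Pi$ for every $s$ and its values $\mathcal L^\lambda_s$, $C_s$, $F_s$ do not depend on $s$. Write $F^\lambda$ for the average transmission cost of a $\lambda$-optimal policy. **Proposition.** For every $F_{\max}\in(0,1]$ the outer problem $$\sup_{\lambda\ge0}\ \Big(\inf_{\pi\in\Pi}\mathcal L_s^\lambda(\pi)-\lambda F_{\max}\Big)$$ has a solution. Precisely: for every $\lambda\ge0$ there is a stationary deterministic $\lambda$-optimal policy, so that $F^\lambda$ is defined, and $$\gamma=\inf\{\lambda\ge0:\ F^\lambda\le F_{\max}\}$$ (with $\inf\emptyset=\infty$) does not depend on which $\lambda$-optimal policies are used to define $F^\lambda$, satisfies $0\le\gamma<\infty$,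 and attains the supremum in the outer problem for every initial state $s$. -/

import Mathlib

open Filter

noncomputable section

/-- Parameters of a remote-estimation system with `M` sources.  Source `m` is a Markov chain on
the nonempty finite set `Fin (N m)` with transition matrix `Q m`.  One packet at a time is sent over
a channel with success probability `ps`.  `oneDelay = false` is the zero-delay case (`d = 0`),
`oneDelay = true` is the one-delay case (`d = 1`). -/
structure RemoteSystem (M : ℕ) where
  N : Fin M → ℕ
  N_pos : ∀ m, 0 < N m
  Q : (m : Fin M) → Matrix (Fin (N m)) (Fin (N m)) ℝ
  Q_stochastic : ∀ m, Q m ∈ Matrix.rowStochastic ℝ (Fin (N m))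
  ps : ℝ
  ps_nonneg : 0 ≤ ps
  ps_le_one : ps ≤ 1
  oneDelay : Bool
  /-- control cost of source state `i` and reconstructed state `j` -/
  δ : (m : Fin M) → Fin (N m) → Fin (N m) → NNReal
  /-- relative significance of the sources -/
  ω : Fin M → ℝ

namespace RemoteSystem

variable {M : ℕ}

/-- System states: for every source, the pair (source state, reconstructed state), that is
`(X_t, X̂_{t-1})` for zero delay and `(X_t, X̂_t)` for one delay. -/
abbrev State (sys : RemoteSystem M) : Type :=
  (m : Fin M) → Fin (sys.N m) × Fin (sys.N m)

/-- Actions: `none` is "stay silent", `some m` is "sample source `m` and transmit". -/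
abbrev Action (_sys : RemoteSystem M) : Type := Option (Fin M)

/-- Transition probability of subsystem `m` from `x = (i, j)` to `y`: the source moves by `Q m`,
the reconstructed state becomes `i` if `m` is transmitted successfully, and otherwise stays `j`. -/
def subTrans (sys : RemoteSystem M) (m : Fin M) (x : Fin (sys.N m) × Fin (sys.N m))
    (a : sys.Action) (y : Fin (sys.N m) × Fin (sys.N m)) : ℝ :=
  sys.Q m x.1 y.1 *
    (if a = some m then
      (if y.2 = x.1 then sys.ps else 0) + (if y.2 = x.2 then 1 - sys.ps else 0)
    else if y.2 = x.2 then 1 else 0)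

/-- The transition function `P(s' | s, a)`. -/
def trans (sys : RemoteSystem M) (s : sys.State) (a : sys.Action) (s' : sys.State) : ℝ :=
  ∏ m, sys.subTrans m (s m) a (s' m)

/-- Cost of actuation error `∑ ω_m δ^m(X_{t+d}, X̂_{t+d})`, in terms of `s = S_t`, `s' = S_{t+1}`.
For zero delay `X_t` is read off `S_t` and `X̂_t` off `S_{t+1}`. -/
def actCost (sys : RemoteSystem M) (s : sys.State) (_a : sys.Action) (s' : sys.State) : ℝ :=
  ∑ m, sys.ω m * (sys.δ m (if sys.oneDelay then (s' m).1 else (s m).1) (s' m).2 : ℝ)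

/-- Transmission cost: the indicator of `a ≠ none`. -/
def txCost (sys : RemoteSystem M) (_s : sys.State) (a : sys.Action) (_s' : sys.State) : ℝ :=
  if a ≠ none then 1 else 0

/-- Lagrangian instantaneous cost. -/
def lagCost (sys : RemoteSystem M) (lam : ℝ) (s : sys.State) (a : sys.Action)
    (s' : sys.State) : ℝ :=
  sys.actCost s a s' + lam * sys.txCost s a s'

/-- History-dependent randomized policies: at time `t + 1` the decision rule maps the first `t`
state-action pairs and the current state to a probability distribution on the actions. -/
abbrev Policy (sys : RemoteSystem M) : Type :=
  (t : ℕ) → (Fin t → sys.State × sys.Action) → sys.State → stdSimplex ℝ sys.Action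

/-- The stationary Markovian deterministic policy given by a map from states to actions. -/
def detPolicy (sys : RemoteSystem M) (μ : sys.State → sys.Action) : sys.Policy :=
  fun _ _ s => ⟨Pi.single (μ s) 1, single_mem_stdSimplex ℝ (μ s)⟩

/-- Probability, under policy `π` and from initial state `s₁`, that the first `t` state-action
pairs are `h` and that the state at time `t + 1` is the last argument. -/
def histProb (sys : RemoteSystem M) (π : sys.Policy) (s₁ : sys.State) :
    (t : ℕ) → (Fin t → sys.State × sys.Action) → sys.State → ℝ
  | 0, _, s => if s = s₁ then 1 else 0
  | t + 1, h, s' =>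
      histProb sys π s₁ t (Fin.init h) (h (Fin.last t)).1 *
        (π t (Fin.init h) (h (Fin.last t)).1 : sys.Action → ℝ) (h (Fin.last t)).2 *
        sys.trans (h (Fin.last t)).1 (h (Fin.last t)).2 s'

/-- `E^π[g(S_{t+1}, A_{t+1}, S_{t+2}) | S_1 = s₁]`. -/
def expCost (sys : RemoteSystem M) (g : sys.State → sys.Action → sys.State → ℝ)
    (π : sys.Policy) (s₁ : sys.State) (t : ℕ) : ℝ :=
  ∑ h : Fin (t + 1) → sys.State × sys.Action, ∑ s' : sys.State,
    sys.histProb π s₁ (t + 1) h s' * g (h (Fin.last t)).1 (h (Fin.last t)).2 s'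

/-- Limsup average cost of `π` from initial state `s₁` for the one-step cost `g`. -/
def avgCost (sys : RemoteSystem M) (g : sys.State → sys.Action → sys.State → ℝ)
    (π : sys.Policy) (s₁ : sys.State) : ℝ :=
  limsup (fun T : ℕ => (∑ t ∈ Finset.range T, sys.expCost g π s₁ t) / (T : ℝ)) atTop

/-- Average cost of actuation error `C_s(π)`. -/
def avgAct (sys : RemoteSystem M) (π : sys.Policy) (s : sys.State) : ℝ :=
  sys.avgCost sys.actCost π s

/-- Average transmission cost `F_s(π)`. -/
def avgTx (sys : RemoteSystem M) (π : sys.Policy) (s : sys.State) : ℝ :=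
  sys.avgCost sys.txCost π s

/-- Lagrangian average cost `L_s^λ(π)`. -/
def avgLag (sys : RemoteSystem M) (lam : ℝ) (π : sys.Policy) (s : sys.State) : ℝ :=
  sys.avgCost (sys.lagCost lam) π s

/-- `π` is `λ`-optimal: it minimizes the Lagrangian average cost over all policies from every
initial state, and its three average costs do not depend on the initial state. -/
def IsLambdaOptimal (sys : RemoteSystem M) (lam : ℝ) (π : sys.Policy) : Prop :=
  (∀ s, ∀ π' : sys.Policy, sys.avgLag lam π s ≤ sys.avgLag lam π' s) ∧
  (∃ l : ℝ, ∀ s, sys.avgLag lam π s = l) ∧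
  (∃ c : ℝ, ∀ s, sys.avgAct π s = c) ∧
  (∃ f : ℝ, ∀ s, sys.avgTx π s = f)

/-- `F` is a version of `λ ↦ F^λ`: each `F λ`, `λ ≥ 0`, is the average transmission cost of
some `λ`-optimal policy. -/
def IsOptimalFrequency (sys : RemoteSystem M) (F : ℝ → ℝ) : Prop :=
  ∀ lam, 0 ≤ lam → ∃ π : sys.Policy, sys.IsLambdaOptimal lam π ∧ ∀ s, sys.avgTx π s = F lam

/-- Objective of the outer problem: `inf_π L_s^λ(π) - λ F_max`. -/
def outerObjective (sys : RemoteSystem M) (Fmax : ℝ) (s : sys.State) (lam : ℝ) : ℝ :=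
  (⨅ π : sys.Policy, sys.avgLag lam π s) - lam * Fmax

end RemoteSystem

/-- `inf {λ ≥ 0 : F λ ≤ F_max}` in the extended reals, equal to `⊤` if there is no such `λ`. -/
def gammaValue (F : ℝ → ℝ) (Fmax : ℝ) : EReal :=
  sInf ((fun lam : ℝ => (lam : EReal)) '' {lam : ℝ | 0 ≤ lam ∧ F lam ≤ Fmax})

end

/-! For fixed `λ` the controlled chain is communicating: silence drives all sources to any
prescribed states in a common number of slots, and transmissions set the reconstructions one source
at a time (`reaches_all`). Vanishing discount then yields the optimality equation with a constant
gain `G λ`. A greedy policy, kept on one closed class and steered towards it elsewhere, is still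
optimal and has a state reachable from everywhere; Poisson equations make all its average costs
independent of the initial state (`exists_unichain_optimal`).

Heuristically `G` is an infimum of the affine functions `C + λF`, hence concave, and each version of
`F^λ` is a supergradient. Since limsups do not add, the supergradient inequality is derived at
finite horizons, where the Lagrangian cost splits exactly and where the optimality equation bounds
every policy from below up to `O(1/T)` (`exists_le_cesaro`).

The rest is one-variable concave duality. Two selections of supergradients interlace, so they cross
the level `Fmax` at the same point `γ`, and `G λ - λ Fmax` is maximal there. The crossing is finite
because the silent policy bounds `G` above, while a supergradient staying above `Fmax > 0` would
make `G` grow without bound. -/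

/-- Along a path from a maximizer, a function that is nearly superharmonic for every action drops
by an amount that depends only on the path. -/
lemma exists_drop_bound {S A : Type*} [Fintype S] {P : S → A → S → ℝ} (hP : ∀ s a s', 0 ≤ P s a s')
    (hP1 : ∀ s a, ∑ s', P s a s' = 1) (B : ℝ) {s s' : S}
    (h : Relation.ReflTransGen (fun s s' => ∃ a, 0 < P s a s') s s') :
    ∃ C : ℝ, ∀ (w : S → ℝ) (W : ℝ), (∀ s, w s ≤ W) → w s = W →
      (∀ s a, w s ≤ B + ∑ s', P s a s' * w s') → W - w s' ≤ C := by
  induction h with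
  | refl => exact ⟨0, fun w W _ h _ => by linarith⟩
  | @tail b c _ hbc ih =>
    obtain ⟨C, hC⟩ := ih
    obtain ⟨a, ha⟩ := hbc
    refine ⟨(C + B) / P b a c, fun w W hW hs hw => ?_⟩
    have h1 := hC w W hW hs hw
    have h2 := hw b a
    have h3 : P b a c * (W - w c) ≤ ∑ x, P b a x * (W - w x) :=
      Finset.single_le_sum (f := fun x => P b a x * (W - w x))
        (fun x _ => mul_nonneg (hP b a x) (by linarith [hW x])) (Finset.mem_univ c)
    simp only [mul_sub, Finset.sum_sub_distrib, ← Finset.sum_mul, hP1] at h3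
    rw [le_div_iff₀ ha]
    linarith

/-! ### Average cost optimality equation by vanishing discount -/

section FiniteMDP

variable {S A : Type*} [Fintype S] [Fintype A] [Nonempty A]

/-- The dynamic programming operator of the finite Markov decision process with transition
function `P` and expected one-step cost `r`. -/
def bellman (P : S → A → S → ℝ) (r : S → A → ℝ) (w : S → ℝ) (s : S) : ℝ :=
  Finset.univ.inf' Finset.univ_nonempty (fun a => r s a + ∑ s', P s a s' * w s')

lemma bellman_le (P : S → A → S → ℝ) (r : S → A → ℝ) (w : S → ℝ) (s : S) (a : A) :
    bellman P r w s ≤ r s a + ∑ s', P s a s' * w s' :=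
  Finset.inf'_le _ (Finset.mem_univ a)

lemma exists_bellman_eq (P : S → A → S → ℝ) (r : S → A → ℝ) (w : S → ℝ) (s : S) :
    ∃ a, bellman P r w s = r s a + ∑ s', P s a s' * w s' := by
  obtain ⟨a, -, ha⟩ := Finset.exists_mem_eq_inf' (Finset.univ_nonempty (α := A))
    (fun a => r s a + ∑ s', P s a s' * w s')
  exact ⟨a, ha⟩

lemma bellman_le_bellman_add {P : S → A → S → ℝ} (hP : ∀ s a s', 0 ≤ P s a s')
    (hP1 : ∀ s a, ∑ s', P s a s' = 1) (r : S → A → ℝ) {v w : S → ℝ} {c : ℝ}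
    (h : ∀ s, v s ≤ w s + c) (s : S) : bellman P r v s ≤ bellman P r w s + c := by
  obtain ⟨a, ha⟩ := exists_bellman_eq P r w s
  calc bellman P r v s ≤ r s a + ∑ s', P s a s' * v s' := bellman_le P r v s a
    _ ≤ r s a + ∑ s', P s a s' * (w s' + c) := by
        gcongr with s' _
        · exact hP s a s'
        · exact h s'
    _ = bellman P r w s + c := by
        rw [ha]; simp only [mul_add, Finset.sum_add_distrib, ← Finset.sum_mul, hP1]; ring

/-- Monotonicity and compatibility with constant shifts make the discounted operator a
`β`-contraction in the sup norm, so Banach's theorem applies. -/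
lemma exists_discounted_fixedPoint {P : S → A → S → ℝ} (hP : ∀ s a s', 0 ≤ P s a s')
    (hP1 : ∀ s a, ∑ s', P s a s' = 1) (r : S → A → ℝ) (β : NNReal) (hβ : β < 1) :
    ∃ v : S → ℝ, ∀ s, v s = bellman P r (fun s' => β * v s') s := by
  have hc : ContractingWith β (fun v : S → ℝ => bellman P r (fun s' => β * v s')) := by
    refine ⟨hβ, LipschitzWith.of_dist_le_mul fun v w => ?_⟩
    have key : ∀ v w : S → ℝ, ∀ s, bellman P r (fun s' => β * v s') s ≤
        bellman P r (fun s' => β * w s') s + β * dist v w := by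
      intro v w s
      refine bellman_le_bellman_add hP hP1 r (fun s' => ?_) s
      have h1 : v s' - w s' ≤ dist v w := (le_abs_self _).trans (dist_le_pi_dist v w s')
      have := mul_le_mul_of_nonneg_left h1 β.2
      simp only [NNReal.val_eq_coe] at this
      linarith
    rw [dist_pi_le_iff (by positivity)]
    intro s
    rw [Real.dist_eq, abs_le]
    have h1 := key v w s
    have h2 := key w v s
    rw [dist_comm w v] at h2
    constructor <;> linarith
  exact ⟨hc.fixedPoint, fun s => (congrFun hc.fixedPoint_isFixedPt s).symm⟩

/-- Average cost optimality equation for a communicating finite Markov decision process. -/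
theorem exists_average_cost_optimality [Nonempty S] {P : S → A → S → ℝ} (hP : ∀ s a s', 0 ≤ P s a s')
    (hP1 : ∀ s a, ∑ s', P s a s' = 1) (r : S → A → ℝ)
    (hcomm : ∀ s s', Relation.ReflTransGen (fun s s' => ∃ a, 0 < P s a s') s s') :
    ∃ (g : ℝ) (w : S → ℝ), ∀ s, g + w s = bellman P r w s := by
  obtain ⟨B, hB⟩ : ∃ B : ℝ, ∀ s a, |r s a| ≤ B := by
    obtain ⟨B, hB⟩ := Finite.bddAbove_range (fun x : S × A => |r x.1 x.2|)
    exact ⟨B, fun s a => hB ⟨(s, a), rfl⟩⟩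
  -- One `B` bounds the one-step cost, the other bounds the normalized gain `(1 - β) * v i`
  -- subtracted from it below.
  choose C hC using fun s s' => exists_drop_bound hP hP1 (2 * B) (hcomm s s')
  obtain ⟨D, hD⟩ : ∃ D : ℝ, ∀ s s', C s s' ≤ D := by
    obtain ⟨B, hB⟩ := Finite.bddAbove_range (fun x : S × S => C x.1 x.2)
    exact ⟨B, fun s a => hB ⟨(s, a), rfl⟩⟩
  -- The discounted equation, recentred at a minimizer of `v`. The bounds do not depend on `β`,
  -- which gives compactness as `β → 1`.
  have main : ∀ β : NNReal, β < 1 → ∃ (g : ℝ) (w : S → ℝ), g ∈ Set.Icc (-B) B ∧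
      (∀ s, w s ∈ Set.Icc 0 D) ∧ ∀ s, g + w s = bellman P r (fun s' => β * w s') s := by
    intro β hβ
    have hβ' : (β : ℝ) < 1 := hβ
    have hβ0 : (0 : ℝ) ≤ β := β.2
    obtain ⟨v, hv⟩ := exists_discounted_fixedPoint hP hP1 r β hβ
    obtain ⟨i, hi⟩ := Finite.exists_min v
    obtain ⟨k, hk⟩ := Finite.exists_max v
    have hw : ∀ s, (1 - β) * v i + (v s - v i) =
        bellman P r (fun s' => β * (v s' - v i)) s := by
      intro s
      have h1 := bellman_le_bellman_add hP hP1 r (v := fun s' => β * (v s' - v i))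
        (w := fun s' => β * v s') (c := - (β * v i)) (fun s => by linarith) s
      have h2 := bellman_le_bellman_add hP hP1 r (w := fun s' => β * (v s' - v i))
        (v := fun s' => β * v s') (c := β * v i) (fun s => by linarith) s
      have := hv s
      linarith
    have hlow : -B ≤ (1 - β) * v i := by
      have h1 := hw i
      obtain ⟨a, ha⟩ := exists_bellman_eq P r (fun s' => β * (v s' - v i)) i
      have h2 : 0 ≤ ∑ s', P i a s' * (β * (v s' - v i)) :=
        Finset.sum_nonneg fun s' _ => mul_nonneg (hP _ _ _)
          (mul_nonneg hβ0 (by linarith [hi s']))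
      have := (abs_le.1 (hB i a)).1
      linarith
    have hupp : (1 - β) * v i ≤ B := by
      have h0 : (1 - β) * v i ≤ (1 - β) * v k :=
        mul_le_mul_of_nonneg_left (hi k) (by linarith)
      obtain ⟨a⟩ := ‹Nonempty A›
      have h1 := bellman_le P r (fun s' => β * v s') k a
      have h2 : ∑ s', P k a s' * (β * v s') ≤ ∑ s', P k a s' * (β * v k) :=
        Finset.sum_le_sum fun s' _ => mul_le_mul_of_nonneg_left
          (mul_le_mul_of_nonneg_left (hk s') hβ0) (hP _ _ _)
      rw [← Finset.sum_mul, hP1, one_mul] at h2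
      have := (abs_le.1 (hB k a)).2
      have := hv k
      linarith
    refine ⟨(1 - β) * v i, fun s => v s - v i, ⟨hlow, hupp⟩, fun s => ⟨?_, ?_⟩, hw⟩
    · linarith [hi s]
    · have h1 := hC k i (fun s => v s - v i) (v k - v i) (fun s => by linarith [hk s]) rfl
        (fun s a => by
          have h1 := bellman_le P r (fun s' => β * (v s' - v i)) s a
          have h2 : ∑ s', P s a s' * (β * (v s' - v i)) ≤ ∑ s', P s a s' * (v s' - v i) :=
            Finset.sum_le_sum fun s' _ => mul_le_mul_of_nonneg_left
              (mul_le_of_le_one_left (by linarith [hi s']) hβ'.le) (hP _ _ _)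
          have := (abs_le.1 (hB s a)).2
          have := hw s
          linarith)
      have := hD k i
      have := hk s
      linarith
  have hβ : ∀ n : ℕ, (1 - 1 / ((n : NNReal) + 1) : NNReal) < 1 := fun n =>
    tsub_lt_self one_pos (by positivity)
  choose g w hg hw hgw using fun n : ℕ => main _ (hβ n)
  obtain ⟨⟨g₀, w₀⟩, -, φ, hφ, hlim⟩ :=
    ((isCompact_Icc (a := -B) (b := B)).prod
      (isCompact_univ_pi fun _ : S => isCompact_Icc (a := 0) (b := D))).tendsto_subseq
      (x := fun n => (g n, w n)) (fun n => ⟨hg n, fun s _ => hw n s⟩)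
  rw [nhds_prod_eq] at hlim
  have hg' : Tendsto (fun n => g (φ n)) atTop (nhds g₀) := hlim.fst
  have hw' : ∀ s, Tendsto (fun n => w (φ n) s) atTop (nhds (w₀ s)) :=
    tendsto_pi_nhds.1 hlim.snd
  have hβlim : Tendsto (fun n => (((1 - 1 / ((φ n : NNReal) + 1) : NNReal)) : ℝ)) atTop
      (nhds 1) := by
    have h1 : Tendsto (fun n : ℕ => (1 : ℝ) - 1 / ((n : ℝ) + 1)) atTop (nhds (1 - 0)) :=
      tendsto_const_nhds.sub tendsto_one_div_add_atTop_nhds_zero_nat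
    rw [sub_zero] at h1
    refine (h1.comp hφ.tendsto_atTop).congr fun n => ?_
    rw [NNReal.coe_sub]
    · simp
    · rw [div_le_one (by positivity)]; simp
  refine ⟨g₀, w₀, fun s => ?_⟩
  have hrhs : ∀ a, Tendsto (fun n => r s a + ∑ s', P s a s' *
      (((1 - 1 / ((φ n : NNReal) + 1) : NNReal) : ℝ) * w (φ n) s')) atTop
      (nhds (r s a + ∑ s', P s a s' * w₀ s')) := by
    intro a
    refine tendsto_const_nhds.add (tendsto_finsetSum _ fun s' _ => ?_)
    simpa using (hβlim.mul (hw' s')).const_mul (P s a s')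
  have hT := Tendsto.finset_inf'_nhds_apply (Finset.univ_nonempty (α := A))
    (fun a _ => hrhs a)
  exact tendsto_nhds_unique (hg'.add (hw' s)) (hT.congr fun n => (hgw (φ n) s).symm)

end FiniteMDP

/-! ### Harmonic functions and the Poisson equation -/

section MarkovChain

variable {S : Type*} [Fintype S]

lemma mean_sub_le_of_isMax {p : S → ℝ} (hp : ∀ x, 0 ≤ p x) (hp1 : ∑ x, p x = 1) {u : S → ℝ}
    {c : ℝ} (h : ∀ x, 0 < p x → u x ≤ c) : ∑ x, p x * u x ≤ c := by
  calc ∑ x, p x * u x ≤ ∑ x, p x * c := Finset.sum_le_sum fun x _ => by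
        rcases (hp x).eq_or_lt with h0 | h0
        · simp [← h0]
        · exact mul_le_mul_of_nonneg_left (h x h0) h0.le
    _ = c := by rw [← Finset.sum_mul, hp1, one_mul]

/-- On a set that is closed for the chain, `u + c = P u` forces `c ≤ 0`. -/
lemma drift_nonpos {p : S → S → ℝ} (hp : ∀ s x, 0 ≤ p s x) (hp1 : ∀ s, ∑ x, p s x = 1)
    {R : Set S} (hR : R.Nonempty) (hcl : ∀ s ∈ R, ∀ x, 0 < p s x → x ∈ R) {u : S → ℝ} {c : ℝ}
    (h : ∀ s ∈ R, c + u s = ∑ x, p s x * u x) : c ≤ 0 := by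
  obtain ⟨k, hk, hmax⟩ := R.toFinite.exists_maximalFor u R hR
  have := mean_sub_le_of_isMax (hp k) (hp1 k) (u := u) (c := u k)
    (fun x hx => by
      by_contra! hlt
      exact absurd (hmax (hcl k hk x hx) hlt.le) (not_le.2 hlt))
  linarith [h k hk]

/-- Apply the maximum principle to `u` and to `-u`. This is what makes a gain computable from any
closed set of states. -/
lemma drift_eq_zero {p : S → S → ℝ} (hp : ∀ s x, 0 ≤ p s x) (hp1 : ∀ s, ∑ x, p s x = 1)
    {R : Set S} (hR : R.Nonempty) (hcl : ∀ s ∈ R, ∀ x, 0 < p s x → x ∈ R) {u : S → ℝ} {c : ℝ}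
    (h : ∀ s ∈ R, c + u s = ∑ x, p s x * u x) : c = 0 := by
  refine le_antisymm (drift_nonpos hp hp1 hR hcl h) ?_
  have := drift_nonpos hp hp1 hR hcl (u := fun x => - u x) (c := -c) (fun s hs => by
    simp only [mul_neg, Finset.sum_neg_distrib, ← h s hs]; ring)
  linarith

/-- A harmonic function attains its maximum at every state that is reachable from everywhere. -/
lemma harmonic_le {p : S → S → ℝ} (hp : ∀ s x, 0 ≤ p s x) (hp1 : ∀ s, ∑ x, p s x = 1)
    {s₀ : S} (hreach : ∀ s, Relation.ReflTransGen (fun s x => 0 < p s x) s s₀) {u : S → ℝ}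
    (h : ∀ s, u s = ∑ x, p s x * u x) (s : S) : u s ≤ u s₀ := by
  have : Nonempty S := ⟨s⟩
  obtain ⟨k, hk⟩ := Finite.exists_max u
  suffices u k = u s₀ from this ▸ hk s
  have key : ∀ x, Relation.ReflTransGen (fun s x => 0 < p s x) k x → u k = u x := by
    intro x hx
    induction hx with
    | refl => rfl
    | @tail b c _ hbc ih =>
      have h3 : p b c * (u k - u c) ≤ ∑ x, p b x * (u k - u x) :=
        Finset.single_le_sum (f := fun x => p b x * (u k - u x))
          (fun x _ => mul_nonneg (hp b x) (by linarith [hk x])) (Finset.mem_univ c)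
      simp only [mul_sub, Finset.sum_sub_distrib, ← Finset.sum_mul, hp1, ← h b] at h3
      have h4 : p b c * (u k - u c) ≤ 0 := by linarith
      have h5 : u k - u c ≤ 0 := nonpos_of_mul_nonpos_right h4 hbc
      linarith [hk c]
  exact key s₀ (hreach k)

/-- Poisson equation for a finite Markov chain with a state that is reachable from everywhere. -/
theorem exists_poisson {p : S → S → ℝ} (hp : ∀ s x, 0 ≤ p s x) (hp1 : ∀ s, ∑ x, p s x = 1)
    {s₀ : S} (hreach : ∀ s, Relation.ReflTransGen (fun s x => 0 < p s x) s s₀) (f : S → ℝ) :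
    ∃ (g : ℝ) (u : S → ℝ), ∀ s, g + u s = f s + ∑ x, p s x * u x := by
  -- `I - P` kills constants; adding `u s₀` removes this kernel. Injectivity then gives surjectivity
  -- by dimension, and the gain is read off as `u s₀`.
  let Φ : (S → ℝ) →ₗ[ℝ] (S → ℝ) :=
    { toFun := fun u s => u s - ∑ x, p s x * u x + u s₀
      map_add' := fun u v => by
        ext s; simp only [Pi.add_apply, mul_add, Finset.sum_add_distrib]; ring
      map_smul' := fun c u => by
        ext s
        simp only [Pi.smul_apply, smul_eq_mul, RingHom.id_apply, mul_add, mul_sub,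
          Finset.mul_sum, mul_left_comm c] }
  have hinj : Function.Injective Φ := by
    rw [← LinearMap.ker_eq_bot, LinearMap.ker_eq_bot']
    intro u hu
    have h1 : ∀ s, u s₀ + u s = ∑ x, p s x * u x := fun s => by
      have : u s - ∑ x, p s x * u x + u s₀ = 0 := congrFun hu s
      linarith
    have h0 : u s₀ = 0 := drift_eq_zero hp hp1 ⟨s₀, Set.mem_univ s₀⟩
      (fun _ _ _ _ => Set.mem_univ _) (fun s _ => h1 s)
    have h2 : ∀ s, u s = ∑ x, p s x * u x := fun s => by rw [← h1 s, h0, zero_add]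
    ext s
    refine le_antisymm ((harmonic_le hp hp1 hreach h2 s).trans h0.le) ?_
    have := harmonic_le hp hp1 hreach (u := fun x => - u x)
      (fun s => by simp only [mul_neg, Finset.sum_neg_distrib, ← h2 s]) s
    simp only [Pi.zero_apply]
    linarith
  obtain ⟨u, hu⟩ := LinearMap.injective_iff_surjective.1 hinj f
  refine ⟨u s₀, u, fun s => ?_⟩
  have : u s - ∑ x, p s x * u x + u s₀ = f s := congrFun hu s
  linarith

/-- A finite directed graph has a vertex that is reachable from everything it reaches. -/
lemma exists_recurrent [Nonempty S] (E : S → S → Prop) :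
    ∃ s₀, ∀ x, Relation.ReflTransGen E s₀ x → Relation.ReflTransGen E x s₀ := by
  obtain ⟨s₀, hs₀⟩ := Finite.exists_min
    (fun s => Set.ncard {x | Relation.ReflTransGen E s x})
  refine ⟨s₀, fun x hx => ?_⟩
  have hsub : {y | Relation.ReflTransGen E x y} ⊆ {y | Relation.ReflTransGen E s₀ y} :=
    fun y hy => hx.trans hy
  have heq := Set.eq_of_subset_of_ncard_le hsub (hs₀ x) (Set.toFinite _)
  have : s₀ ∈ {y | Relation.ReflTransGen E s₀ y} := Relation.ReflTransGen.refl
  rw [← heq] at this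
  exact this

end MarkovChain

/-! ### Optimal policies with a state reachable from everywhere -/

section Unichain

variable {S A : Type*}

/-- If `s₀` is reachable from every state, a policy can be changed outside a set so that the set is
reached from every state. -/
lemma exists_steering (E : S → A → S → Prop) (R : Set S) (μ : S → A)
    (hreach : ∀ s, ∃ x ∈ R, Relation.ReflTransGen (fun s s' => ∃ a, E s a s') s x) :
    ∃ ν : S → A, (∀ s ∈ R, ν s = μ s) ∧
      ∀ s, ∃ x ∈ R, Relation.ReflTransGen (fun s s' => E s (ν s) s') s x := by
  -- `D n` holds the states from which some choice of actions leads to `R` in exactly `n` steps.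
  -- Outside `R`, `ν` picks an action that can decrease the least such `n`.
  let D : ℕ → Set S := fun n => Nat.rec R (fun _ D => {s | ∃ a, ∃ s' ∈ D, E s a s'}) n
  have hD : ∀ s, ∃ n, s ∈ D n := by
    intro s
    obtain ⟨x, hx, h⟩ := hreach s
    induction h using Relation.ReflTransGen.head_induction_on with
    | refl => exact ⟨0, hx⟩
    | head h _ ih =>
      obtain ⟨n, hn⟩ := ih
      obtain ⟨a, ha⟩ := h
      exact ⟨n + 1, a, _, hn, ha⟩
  let d : S → ℕ := fun s => sInf {n | s ∈ D n}
  have hstep : ∀ s, ∃ a, (s ∈ R → a = μ s) ∧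
      (s ∉ R → ∃ s', E s a s' ∧ d s' < d s) := by
    intro s
    by_cases hs : s ∈ R
    · exact ⟨μ s, fun _ => rfl, fun h => absurd hs h⟩
    · have hf : s ∈ D (d s) := Nat.sInf_mem (hD s)
      rcases hn : d s with _ | n
      · rw [hn] at hf; exact absurd hf hs
      · rw [hn] at hf
        obtain ⟨a, s', hs', hE⟩ := hf
        exact ⟨a, fun h => absurd h hs, fun _ => ⟨s', hE,
          Nat.lt_succ_of_le (Nat.sInf_le hs')⟩⟩
  choose ν hν1 hν2 using hstep
  refine ⟨ν, hν1, fun s => ?_⟩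
  induction hn : d s using Nat.strong_induction_on generalizing s with
  | _ n ih =>
    by_cases hs : s ∈ R
    · exact ⟨s, hs, .refl⟩
    · obtain ⟨s', hE, hlt⟩ := hν2 s hs
      obtain ⟨x, hx, h⟩ := ih _ (hn ▸ hlt) s' rfl
      exact ⟨x, hx, .head hE h⟩

variable [Fintype S] [Nonempty S] [Fintype A] [Nonempty A]

/-- A communicating finite Markov decision process has an optimal stationary deterministic policy
under which one state is reachable from everywhere; `g` is the optimal average cost. -/
theorem exists_unichain_optimal {P : S → A → S → ℝ} (hP : ∀ s a s', 0 ≤ P s a s')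
    (hP1 : ∀ s a, ∑ s', P s a s' = 1) (r : S → A → ℝ)
    (hcomm : ∀ s s', Relation.ReflTransGen (fun s s' => ∃ a, 0 < P s a s') s s') :
    ∃ (g : ℝ) (w u : S → ℝ) (ν : S → A) (s₀ : S),
      (∀ s a, g + w s ≤ r s a + ∑ s', P s a s' * w s') ∧
      (∀ s, g + u s = r s (ν s) + ∑ s', P s (ν s) s' * u s') ∧
      ∀ s, Relation.ReflTransGen (fun s s' => 0 < P s (ν s) s') s s₀ := by
  obtain ⟨g, w, hgw⟩ := exists_average_cost_optimality hP hP1 r hcomm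
  choose μ hμ using exists_bellman_eq P r w
  obtain ⟨s₀, hs₀⟩ := exists_recurrent (fun s s' => 0 < P s (μ s) s')
  -- The states reachable from `s₀` under `μ` form a closed class. Outside it `ν` need not be
  -- greedy, so a new relative value `u` is required.
  obtain ⟨ν, hνR, hν⟩ := exists_steering (fun s a s' => 0 < P s a s')
    {x | Relation.ReflTransGen (fun s s' => 0 < P s (μ s) s') s₀ x} μ
    (fun s => ⟨s₀, .refl, hcomm s s₀⟩)
  have hback : ∀ x, Relation.ReflTransGen (fun s s' => 0 < P s (μ s) s') x s₀ →
      Relation.ReflTransGen (fun s s' => 0 < P s (μ s) s') s₀ x →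
      Relation.ReflTransGen (fun s s' => 0 < P s (ν s) s') x s₀ := by
    intro x h
    induction h using Relation.ReflTransGen.head_induction_on with
    | refl => exact fun _ => .refl
    | head h _ ih =>
      intro hx
      refine .head ?_ (ih (hx.tail h))
      rw [hνR _ hx]
      exact h
  have hs₀ν : ∀ s, Relation.ReflTransGen (fun s s' => 0 < P s (ν s) s') s s₀ := by
    intro s
    obtain ⟨x, hx, h⟩ := hν s
    exact h.trans (hback x (hs₀ x hx) hx)
  obtain ⟨g', u, hu⟩ := exists_poisson (fun s x => hP s (ν s) x) (fun s => hP1 s (ν s)) hs₀ν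
    (fun s => r s (ν s))
  -- On the closed class `ν` is greedy, so `w` and `u` solve equations with the same kernel and
  -- cost, and `w - u` has constant drift `g - g'`.
  have hgg : g - g' = 0 := by
    refine drift_eq_zero (fun s x => hP s (ν s) x) (fun s => hP1 s (ν s))
      (R := {x | Relation.ReflTransGen (fun s s' => 0 < P s (μ s) s') s₀ x})
      (u := fun x => w x - u x) ⟨s₀, .refl⟩ (fun s hs x hx => ?_) (fun s hs => ?_)
    · rw [hνR s hs] at hx
      exact hs.tail hx
    · have h1 := hgw s
      have h2 := hμ s
      have h3 := hu s
      rw [← hνR s hs] at h2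
      simp only [mul_sub, Finset.sum_sub_distrib]
      linarith
  obtain rfl : g = g' := by linarith
  exact ⟨g, w, u, ν, s₀, fun s a => (hgw s).trans_le (bellman_le P r w s a), hu, hs₀ν⟩

end Unichain

/-! ### Powers of positive matrices -/

section PositiveMatrix

lemma Matrix.pow_pos_of_forall_pos {n : Type*} [Fintype n] [DecidableEq n] [Nonempty n]
    {A : Matrix n n ℝ} (hA : ∀ i j, 0 < A i j) {l : ℕ} (hl : l ≠ 0) (i j : n) :
    0 < (A ^ l) i j := by
  induction l, Nat.one_le_iff_ne_zero.2 hl using Nat.le_induction generalizing i j with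
  | base => simpa using hA i j
  | succ l hl' ih =>
    rw [pow_succ, Matrix.mul_apply]
    exact Finset.sum_pos (fun x _ => mul_pos (ih (by omega) i x) (hA x j)) Finset.univ_nonempty

end PositiveMatrix

/-! ### Communication between the states of the system -/

namespace RemoteSystem

variable {M : ℕ} (sys : RemoteSystem M)

lemma Q_nonneg (m : Fin M) (i j : Fin (sys.N m)) : 0 ≤ sys.Q m i j :=
  Matrix.nonneg_of_mem_rowStochastic (sys.Q_stochastic m)

lemma Q_sum (m : Fin M) (i : Fin (sys.N m)) : ∑ j, sys.Q m i j = 1 :=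
  Matrix.sum_row_of_mem_rowStochastic (sys.Q_stochastic m) i

lemma subTrans_nonneg (m : Fin M) (x : Fin (sys.N m) × Fin (sys.N m)) (a : sys.Action)
    (y : Fin (sys.N m) × Fin (sys.N m)) : 0 ≤ sys.subTrans m x a y := by
  have h1 := sys.ps_nonneg
  have h2 : 0 ≤ 1 - sys.ps := sub_nonneg.2 sys.ps_le_one
  unfold subTrans
  refine mul_nonneg (sys.Q_nonneg _ _ _) ?_
  split_ifs <;> positivity

lemma subTrans_sum (m : Fin M) (x : Fin (sys.N m) × Fin (sys.N m)) (a : sys.Action) :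
    ∑ y, sys.subTrans m x a y = 1 := by
  unfold subTrans
  rw [Fintype.sum_prod_type]
  simp only [← Finset.mul_sum]
  split_ifs <;> simp [Finset.sum_add_distrib, sys.Q_sum]

lemma trans_nonneg (s : sys.State) (a : sys.Action) (s' : sys.State) : 0 ≤ sys.trans s a s' :=
  Finset.prod_nonneg fun m _ => sys.subTrans_nonneg m _ _ _

lemma trans_sum (s : sys.State) (a : sys.Action) : ∑ s', sys.trans s a s' = 1 := by
  unfold trans
  have := Finset.prod_univ_sum (fun m => (Finset.univ : Finset (Fin (sys.N m) × Fin (sys.N m))))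
    (fun m y => sys.subTrans m (s m) a y)
  rw [Fintype.piFinset_univ] at this
  rw [← this]
  exact Finset.prod_eq_one fun m _ => sys.subTrans_sum m _ _

instance (m : Fin M) : Nonempty (Fin (sys.N m)) := ⟨⟨0, sys.N_pos m⟩⟩

/-- A state is reachable from another one under suitable actions. -/
def Reaches (s s' : sys.State) : Prop :=
  Relation.ReflTransGen (fun s s' => ∃ a, 0 < sys.trans s a s') s s'

/-- The sources move simultaneously, hence one exponent `n` for all of them; under silence the
reconstructions are frozen. -/
lemma reaches_silent (n : ℕ) (x x' j : (m : Fin M) → Fin (sys.N m))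
    (h : ∀ m, 0 < (sys.Q m ^ n) (x m) (x' m)) :
    sys.Reaches (fun m => (x m, j m)) (fun m => (x' m, j m)) := by
  induction n generalizing x' with
  | zero =>
    have : x = x' := by
      ext1 m
      by_contra hne
      simpa [Matrix.one_apply_ne hne] using h m
    exact this ▸ .refl
  | succ n ih =>
    have h1 : ∀ m, ∃ y, 0 < (sys.Q m ^ n) (x m) y ∧ 0 < sys.Q m y (x' m) := by
      intro m
      have hm := h m
      rw [pow_succ, Matrix.mul_apply] at hm
      obtain ⟨y, -, hy⟩ := Finset.exists_lt_of_sum_lt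
        (s := Finset.univ) (f := fun _ => (0 : ℝ)) (by simpa using hm)
      have h0 : 0 ≤ (sys.Q m ^ n) (x m) y :=
        Matrix.nonneg_of_mem_rowStochastic (pow_mem (sys.Q_stochastic m) n)
      exact ⟨y, (pos_iff_pos_of_mul_pos hy).2 (pos_of_mul_pos_right hy h0),
        pos_of_mul_pos_right hy h0⟩
    choose y hy1 hy2 using h1
    refine (ih y hy1).tail ⟨none, Finset.prod_pos fun m _ => ?_⟩
    simpa [subTrans] using hy2 m

lemma reaches_transmit (hps : 0 < sys.ps) (x j : (m : Fin M) → Fin (sys.N m)) (m : Fin M) :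
    ∃ x' : (m : Fin M) → Fin (sys.N m), sys.Reaches (fun k => (x k, j k)) (fun k => (x' k, Function.update j m (x m) k)) := by
  have h1 : ∀ k, ∃ y, 0 < sys.Q k (x k) y := by
    intro k
    obtain ⟨y, -, hy⟩ := Finset.exists_lt_of_sum_lt (s := Finset.univ) (f := fun _ => (0 : ℝ))
      (g := fun y => sys.Q k (x k) y) (by simp [sys.Q_sum])
    exact ⟨y, hy⟩
  choose x' hx' using h1
  refine ⟨x', .single ⟨some m, Finset.prod_pos fun k _ => ?_⟩⟩
  unfold subTrans
  refine mul_pos (hx' k) ?_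
  have h2 : 0 ≤ 1 - sys.ps := sub_nonneg.2 sys.ps_le_one
  by_cases hk : m = k
  · subst hk
    simp only [if_true, Function.update_self]
    split_ifs <;> linarith
  · simp [hk, Function.update_of_ne (Ne.symm hk)]

/-- Under primitive sources and a channel that works with positive probability, the decision
process is communicating. -/
lemma reaches_all (hps : 0 < sys.ps) (hQ : ∀ m, (sys.Q m).IsPrimitive) (s s' : sys.State) :
    sys.Reaches s s' := by
  choose k hk0 hk using fun m => (hQ m).2
  -- The product of the individual exponents is a common one, since positive powers of a positive
  -- matrix remain positive.
  have hn : ∀ m i j, 0 < (sys.Q m ^ ∏ m, k m) i j := by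
    intro m i j
    obtain ⟨l, hl⟩ := Finset.dvd_prod_of_mem k (Finset.mem_univ m)
    rw [hl, pow_mul]
    refine Matrix.pow_pos_of_forall_pos (hk m) ?_ i j
    rintro rfl
    have : 0 < ∏ m, k m := Finset.prod_pos fun m _ => hk0 m
    omega
  have hsilent : ∀ x x' j : (m : Fin M) → Fin (sys.N m),
      sys.Reaches (fun m => (x m, j m)) (fun m => (x' m, j m)) := fun x x' j =>
    sys.reaches_silent _ x x' j fun m => hn m _ _
  have key : ∀ T : Finset (Fin M), ∃ x j : (m : Fin M) → Fin (sys.N m),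
      (∀ m ∈ T, j m = (s' m).2) ∧ sys.Reaches s (fun m => (x m, j m)) := by
    intro T
    induction T using Finset.induction_on with
    | empty => exact ⟨fun m => (s m).1, fun m => (s m).2, by simp, .refl⟩
    | insert m T _ ih =>
      obtain ⟨x, j, hj, hr⟩ := ih
      -- A transmission delivers the source's current state, so the sources are first brought
      -- silently to the target reconstructions.
      obtain ⟨x', hx'⟩ := sys.reaches_transmit hps (fun m => (s' m).2) j m
      refine ⟨x', Function.update j m (s' m).2, fun i hi => ?_,
        (hr.trans (hsilent x _ j)).trans hx'⟩
      rcases eq_or_ne i m with rfl | hne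
      · simp
      · rw [Function.update_of_ne hne]
        exact hj i ((Finset.mem_insert.1 hi).resolve_left hne)
  obtain ⟨x, j, hj, hr⟩ := key Finset.univ
  obtain rfl : j = fun m => (s' m).2 := funext fun m => hj m (Finset.mem_univ m)
  exact hr.trans (hsilent x (fun m => (s' m).1) _)

/-! ### Expected costs -/

lemma histProb_nonneg (π : sys.Policy) (s₁ : sys.State) (t : ℕ)
    (h : Fin t → sys.State × sys.Action) (s : sys.State) : 0 ≤ sys.histProb π s₁ t h s := by
  induction t generalizing s with
  | zero => unfold histProb; split_ifs <;> norm_num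
  | succ t ih =>
    exact mul_nonneg (mul_nonneg (ih _ _) ((π t _ _).2.1 _)) (sys.trans_nonneg _ _ _)

/-- One-step expectation of a cost given the state and the action. -/
noncomputable def meanCost (g : sys.State → sys.Action → sys.State → ℝ) (s : sys.State) (a : sys.Action) : ℝ :=
  ∑ s', sys.trans s a s' * g s a s'

/-- Splits off the last state-action pair of the history and sums out the next state, so that costs
enter only through `meanCost`. -/
lemma expCost_eq (g : sys.State → sys.Action → sys.State → ℝ) (π : sys.Policy) (s₁ : sys.State)
    (t : ℕ) : sys.expCost g π s₁ t =
      ∑ h : Fin t → sys.State × sys.Action, ∑ s, sys.histProb π s₁ t h s *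
        ∑ a, (π t h s : sys.Action → ℝ) a * sys.meanCost g s a := by
  unfold expCost
  rw [← (Fin.snocEquiv (fun _ : Fin (t + 1) => sys.State × sys.Action)).sum_comp,
    Fintype.sum_prod_type, Finset.sum_comm]
  refine Finset.sum_congr rfl fun h _ => ?_
  rw [Fintype.sum_prod_type]
  refine Finset.sum_congr rfl fun s _ => ?_
  rw [Finset.mul_sum]
  refine Finset.sum_congr rfl fun a _ => ?_
  simp only [meanCost, Finset.mul_sum]
  refine Finset.sum_congr rfl fun s' _ => ?_
  have hinit : Fin.init ((Fin.snocEquiv fun _ : Fin (t + 1) => sys.State × sys.Action)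
      ((s, a), h)) = h := Fin.init_snoc _ _
  simp only [histProb, hinit, Fin.snocEquiv_apply, Fin.snoc_last]
  ring

lemma expCost_mono {g g' : sys.State → sys.Action → sys.State → ℝ} (π : sys.Policy)
    (s₁ : sys.State) (t : ℕ) (h : ∀ s a, sys.meanCost g s a ≤ sys.meanCost g' s a) :
    sys.expCost g π s₁ t ≤ sys.expCost g' π s₁ t := by
  rw [expCost_eq, expCost_eq]
  gcongr with k _ s _ a _
  · exact sys.histProb_nonneg _ _ _ _ _
  · exact (π t k s).2.1 a
  · exact h s a

lemma expCost_add (g g' : sys.State → sys.Action → sys.State → ℝ) (π : sys.Policy)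
    (s₁ : sys.State) (t : ℕ) :
    sys.expCost (fun s a s' => g s a s' + g' s a s') π s₁ t =
      sys.expCost g π s₁ t + sys.expCost g' π s₁ t := by
  simp only [expCost, mul_add, Finset.sum_add_distrib]

lemma expCost_const_mul (c : ℝ) (g : sys.State → sys.Action → sys.State → ℝ) (π : sys.Policy)
    (s₁ : sys.State) (t : ℕ) :
    sys.expCost (fun s a s' => c * g s a s') π s₁ t = c * sys.expCost g π s₁ t := by
  simp only [expCost, Finset.mul_sum, mul_left_comm c]

lemma meanCost_of_state (w : sys.State → ℝ) (s : sys.State) (a : sys.Action) :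
    sys.meanCost (fun s _ _ => w s) s a = w s := by
  simp [meanCost, ← Finset.sum_mul, sys.trans_sum]

lemma meanCost_add (g g' : sys.State → sys.Action → sys.State → ℝ) (s : sys.State)
    (a : sys.Action) : sys.meanCost (fun s a s' => g s a s' + g' s a s') s a =
      sys.meanCost g s a + sys.meanCost g' s a := by
  simp only [meanCost, mul_add, Finset.sum_add_distrib]

/-- Expectation of a function of the state at time `t + 1`. -/
noncomputable def expState (π : sys.Policy) (s₁ : sys.State) (t : ℕ) (w : sys.State → ℝ) : ℝ :=
  sys.expCost (fun s _ _ => w s) π s₁ t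

lemma expState_eq (π : sys.Policy) (s₁ : sys.State) (t : ℕ) (w : sys.State → ℝ) :
    sys.expState π s₁ t w =
      ∑ h : Fin t → sys.State × sys.Action, ∑ s, sys.histProb π s₁ t h s * w s := by
  simp only [expState, expCost_eq, meanCost_of_state, ← Finset.sum_mul]
  refine Finset.sum_congr rfl fun h _ => Finset.sum_congr rfl fun s _ => ?_
  have h1 : ∑ a, (π t h s : sys.Action → ℝ) a = 1 := (π t h s).2.2
  rw [h1, one_mul]

lemma expState_zero (π : sys.Policy) (s₁ : sys.State) (w : sys.State → ℝ) :
    sys.expState π s₁ 0 w = w s₁ := by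
  simp [expState_eq, histProb]

lemma expState_succ (π : sys.Policy) (s₁ : sys.State) (t : ℕ) (w : sys.State → ℝ) :
    sys.expState π s₁ (t + 1) w = sys.expCost (fun _ _ s' => w s') π s₁ t := by
  rw [expState_eq, expCost]

lemma expState_const (π : sys.Policy) (s₁ : sys.State) (t : ℕ) (c : ℝ) :
    sys.expState π s₁ t (fun _ => c) = c := by
  induction t with
  | zero => exact sys.expState_zero π s₁ _
  | succ t ih => rw [expState_succ]; exact ih

lemma expState_mono (π : sys.Policy) (s₁ : sys.State) (t : ℕ) {w w' : sys.State → ℝ}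
    (h : ∀ s, w s ≤ w' s) : sys.expState π s₁ t w ≤ sys.expState π s₁ t w' :=
  sys.expCost_mono π s₁ t fun s a => by simpa only [meanCost_of_state] using h s

lemma abs_expState_le (π : sys.Policy) (s₁ : sys.State) (t : ℕ) {w : sys.State → ℝ} {B : ℝ}
    (h : ∀ s, |w s| ≤ B) : |sys.expState π s₁ t w| ≤ B := by
  rw [abs_le]
  constructor
  · rw [← sys.expState_const π s₁ t (-B)]
    exact sys.expState_mono π s₁ t fun s => (abs_le.1 (h s)).1
  · conv_rhs => rw [← sys.expState_const π s₁ t B]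
    exact sys.expState_mono π s₁ t fun s => (abs_le.1 (h s)).2

lemma expCost_detPolicy (g : sys.State → sys.Action → sys.State → ℝ)
    (μ : sys.State → sys.Action) (s₁ : sys.State) (t : ℕ) :
    sys.expCost g (sys.detPolicy μ) s₁ t =
      sys.expState (sys.detPolicy μ) s₁ t (fun s => sys.meanCost g s (μ s)) := by
  rw [expCost_eq, expState_eq]
  simp [detPolicy, Pi.single_apply]

/-- Average of the expected costs over the first `T` slots. -/
noncomputable def cesaro (g : sys.State → sys.Action → sys.State → ℝ) (π : sys.Policy) (s₁ : sys.State)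
    (T : ℕ) : ℝ :=
  (∑ t ∈ Finset.range T, sys.expCost g π s₁ t) / (T : ℝ)

lemma sum_drift (g : sys.State → sys.Action → sys.State → ℝ) (w : sys.State → ℝ)
    (π : sys.Policy) (s₁ : sys.State) (T : ℕ) :
    ∑ t ∈ Finset.range T, (sys.expCost g π s₁ t + sys.expState π s₁ (t + 1) w -
        sys.expState π s₁ t w) =
      ∑ t ∈ Finset.range T, sys.expCost g π s₁ t + (sys.expState π s₁ T w - w s₁) := by
  simp only [add_sub_assoc, Finset.sum_add_distrib]
  rw [Finset.sum_range_sub (fun t => sys.expState π s₁ t w), expState_zero]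

lemma exists_state_bound (w : sys.State → ℝ) : ∃ B : ℝ, ∀ s, |w s| ≤ B := by
  obtain ⟨B, hB⟩ := Finite.bddAbove_range (fun s => |w s|)
  exact ⟨B, fun s => hB ⟨s, rfl⟩⟩

/-- A subsolution of the optimality equation bounds the finite-horizon averages of every
policy from below. -/
lemma exists_le_cesaro {g : sys.State → sys.Action → sys.State → ℝ} {l : ℝ}
    {w : sys.State → ℝ}
    (h : ∀ s a, l + w s ≤ sys.meanCost g s a + ∑ s', sys.trans s a s' * w s') :
    ∃ C : ℝ, ∀ (π : sys.Policy) s₁ (T : ℕ), 0 < T → l - C / T ≤ sys.cesaro g π s₁ T := by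
  obtain ⟨B, hB⟩ := sys.exists_state_bound w
  -- After telescoping, only the two boundary values of `w` remain, each at most `B` in absolute
  -- value.
  refine ⟨2 * B, fun π s₁ T hT => ?_⟩
  have hT' : (0 : ℝ) < T := by exact_mod_cast hT
  have h1 : ∀ t, l ≤ sys.expCost g π s₁ t + sys.expState π s₁ (t + 1) w -
      sys.expState π s₁ t w := by
    intro t
    have := sys.expCost_mono (g := fun s _ _ => l + w s) (g' := fun s a s' => g s a s' + w s')
      π s₁ t fun s a => by
        rw [sys.meanCost_of_state (fun s => l + w s), sys.meanCost_add g (fun _ _ s' => w s')]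
        exact h s a
    rw [sys.expCost_add g (fun _ _ s' => w s'), sys.expCost_add (fun _ _ _ => l)
      (fun s _ _ => w s), ← sys.expState_succ π s₁ t w] at this
    have hc : sys.expCost (fun _ _ _ => l) π s₁ t = l := sys.expState_const π s₁ t l
    rw [hc] at this
    change l + sys.expState π s₁ t w ≤ _ at this
    linarith
  have h2 := Finset.sum_le_sum fun t (_ : t ∈ Finset.range T) => h1 t
  rw [sum_drift, Finset.sum_const, Finset.card_range, nsmul_eq_mul] at h2
  have h3 := (abs_le.1 (sys.abs_expState_le π s₁ T hB)).2
  have h4 := (abs_le.1 (hB s₁)).1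
  rw [cesaro, le_div_iff₀ hT', sub_mul, div_mul_cancel₀ _ hT'.ne']
  linarith

/-- The averages of a stationary deterministic policy converge to the constant in its
Poisson equation. -/
lemma tendsto_cesaro_detPolicy {g : sys.State → sys.Action → sys.State → ℝ}
    {μ : sys.State → sys.Action} {l : ℝ} {u : sys.State → ℝ}
    (h : ∀ s, l + u s = sys.meanCost g s (μ s) + ∑ s', sys.trans s (μ s) s' * u s')
    (s₁ : sys.State) : Tendsto (sys.cesaro g (sys.detPolicy μ) s₁) atTop (nhds l) := by
  obtain ⟨B, hB⟩ := sys.exists_state_bound u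
  have h1 : ∀ t, sys.expCost g (sys.detPolicy μ) s₁ t +
      sys.expState (sys.detPolicy μ) s₁ (t + 1) u - sys.expState (sys.detPolicy μ) s₁ t u = l := by
    intro t
    have e1 : sys.expCost (fun s a s' => g s a s' + u s') (sys.detPolicy μ) s₁ t =
        sys.expCost (fun s _ _ => l + u s) (sys.detPolicy μ) s₁ t := by
      rw [expCost_detPolicy, expCost_detPolicy]
      congr 1
      ext s
      rw [sys.meanCost_of_state (fun s => l + u s), sys.meanCost_add g (fun _ _ s' => u s')]
      exact (h s).symm
    rw [sys.expCost_add g (fun _ _ s' => u s'), sys.expCost_add (fun _ _ _ => l)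
      (fun s _ _ => u s), ← sys.expState_succ _ s₁ t u] at e1
    have hc : sys.expCost (fun _ _ _ => l) (sys.detPolicy μ) s₁ t = l :=
      sys.expState_const _ s₁ t l
    rw [hc] at e1
    change _ = l + sys.expState (sys.detPolicy μ) s₁ t u at e1
    linarith
  have h2 : Tendsto (fun T : ℕ => l + (u s₁ - sys.expState (sys.detPolicy μ) s₁ T u) / (T : ℝ))
      atTop (nhds (l + 0)) := by
    refine tendsto_const_nhds.add ?_
    refine squeeze_zero_norm (a := fun T : ℕ => (2 * B) / (T : ℝ)) (fun T => ?_)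
      (tendsto_const_div_atTop_nhds_zero_nat _)
    rw [norm_div, Real.norm_eq_abs, Real.norm_natCast]
    gcongr
    have := abs_sub (u s₁) (sys.expState (sys.detPolicy μ) s₁ T u)
    linarith [hB s₁, sys.abs_expState_le (sys.detPolicy μ) s₁ T hB]
  rw [add_zero] at h2
  refine h2.congr' ?_
  filter_upwards [eventually_gt_atTop 0] with T hT
  have hT' : (T : ℝ) ≠ 0 := by exact_mod_cast hT.ne'
  have h3 := sys.sum_drift g u (sys.detPolicy μ) s₁ T
  simp only [h1, Finset.sum_const, Finset.card_range, nsmul_eq_mul] at h3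
  rw [cesaro, eq_div_iff hT', add_mul, div_mul_cancel₀ _ hT']
  linarith

end RemoteSystem

/-! ### Supergradients and the maximizer of the dual function -/

section ConcaveDual

/-- `F` selects a supergradient of `G` at every point of `[0, ∞)`. -/
def IsSupergradient (G F : ℝ → ℝ) : Prop :=
  ∀ x y, 0 ≤ x → 0 ≤ y → G y - G x ≤ (y - x) * F x

/-- Add the two supergradient inequalities between `x` and `y`. Allowing different selections at the
two points is what makes the crossing point independent of the selection. -/
lemma IsSupergradient.le_of_lt {G F F' : ℝ → ℝ} (h : IsSupergradient G F)
    (h' : IsSupergradient G F') {x y : ℝ} (hx : 0 ≤ x) (hxy : x < y) : F' y ≤ F x := by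
  have h1 := h x y hx (hx.trans hxy.le)
  have h2 := h' y x (hx.trans hxy.le) hx
  have h3 : 0 ≤ (y - x) * (F x - F' y) := by linarith
  exact sub_nonneg.1 (nonneg_of_mul_nonneg_right h3 (sub_pos.2 hxy))

/-- The least point at which a supergradient falls to `c` maximizes `G x - c x`. -/
lemma IsSupergradient.isMaxOn {G F : ℝ → ℝ} (h : IsSupergradient G F) {c B : ℝ}
    (hB : ∀ x, 0 ≤ x → |F x| ≤ B) (hne : {x | 0 ≤ x ∧ F x ≤ c}.Nonempty) :
    IsMaxOn (fun x => G x - x * c) (Set.Ici 0) (sInf {x | 0 ≤ x ∧ F x ≤ c}) := by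
  set γ := sInf {x | 0 ≤ x ∧ F x ≤ c}
  have hbdd : BddBelow {x | 0 ≤ x ∧ F x ≤ c} := ⟨0, fun x hx => hx.1⟩
  have hγ0 : 0 ≤ γ := le_csInf hne fun x hx => hx.1
  have hB0 : 0 ≤ B := (abs_nonneg _).trans (hB 0 le_rfl)
  intro y hy
  have hy0 : (0 : ℝ) ≤ y := hy
  change G y - y * c ≤ G γ - γ * c
  refine le_of_forall_pos_le_add fun ε hε => ?_
  -- The infimum `γ` need not belong to the level set, so the comparison is made at a nearby `z`.
  -- Passing from `z` to `γ` costs at most `η * (B + |c|)`; the extra `1` keeps the denominator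
  -- positive.
  have hK : 0 < B + |c| + 1 := by positivity
  set η := ε / (B + |c| + 1)
  have hη : 0 < η := div_pos hε hK
  have hηK : η * (B + |c| + 1) = ε := div_mul_cancel₀ _ hK.ne'
  -- a point close to `γ` where the objective is at least its value at `y`
  obtain ⟨z, hz0, hzγ, hz⟩ : ∃ z, 0 ≤ z ∧ |z - γ| ≤ η ∧ G y - y * c ≤ G z - z * c := by
    rcases lt_or_ge γ y with hlt | hge
    · obtain ⟨z, ⟨hz0, hzF⟩, hzlt⟩ := exists_lt_of_csInf_lt hne (lt_min hlt (lt_add_of_pos_right γ hη))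
      have hγz : γ ≤ z := csInf_le hbdd ⟨hz0, hzF⟩
      have hz1 := hzlt.trans_le (min_le_left _ _)
      have hz2 := hzlt.trans_le (min_le_right _ _)
      refine ⟨z, hz0, abs_le.2 ⟨by linarith, by linarith⟩, ?_⟩
      have h1 := h z y hz0 hy0
      have h2 := mul_le_mul_of_nonneg_left hzF (sub_nonneg.2 hz1.le)
      linarith
    · by_cases hz : γ - η ≤ y
      · exact ⟨y, hy0, abs_le.2 ⟨by linarith, by linarith⟩, le_rfl⟩
      · push Not at hz
        have hz0 : 0 ≤ γ - η := hy0.trans hz.le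
        refine ⟨γ - η, hz0, by simp [abs_of_pos hη], ?_⟩
        have hnot : c < F (γ - η) := by
          by_contra! hle
          have := csInf_le hbdd (⟨hz0, hle⟩ : γ - η ∈ {x | 0 ≤ x ∧ F x ≤ c})
          linarith
        have h1 := h (γ - η) y hz0 hy0
        have h2 := mul_le_mul_of_nonneg_left hnot.le (sub_nonneg.2 hz.le)
        linarith
  have h1 := h γ z hγ0 hz0
  have h2 : (z - γ) * (F γ - c) ≤ η * (B + |c|) := by
    refine (le_abs_self _).trans ?_
    rw [abs_mul]
    refine mul_le_mul hzγ ((abs_sub _ _).trans ?_) (abs_nonneg _) hη.le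
    linarith [hB γ hγ0]
  linarith

/-- By interlacing, every point strictly to the right of a point in one level set lies in the other,
so the infima agree. -/
lemma gammaValue_eq_of_isSupergradient {G F F' : ℝ → ℝ} (h : IsSupergradient G F)
    (h' : IsSupergradient G F') {c : ℝ} (hne : {x | 0 ≤ x ∧ F x ≤ c}.Nonempty) :
    gammaValue F' c = ((sInf {x | 0 ≤ x ∧ F x ≤ c} : ℝ) : EReal) := by
  have hbdd : BddBelow {x | 0 ≤ x ∧ F x ≤ c} := ⟨0, fun x hx => hx.1⟩
  refine le_antisymm ?_ ?_
  · refine EReal.le_of_forall_lt_iff_le.1 fun z hz => ?_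
    obtain ⟨x, ⟨hx0, hx⟩, hxz⟩ := exists_lt_of_csInf_lt hne (EReal.coe_lt_coe_iff.1 hz)
    exact sInf_le ⟨z, ⟨hx0.trans hxz.le, (h.le_of_lt h' hx0 hxz).trans hx⟩, rfl⟩
  · refine le_sInf ?_
    rintro _ ⟨x, ⟨hx0, hx⟩, rfl⟩
    refine EReal.coe_le_coe_iff.2 (le_of_forall_gt_imp_ge_of_dense fun z hz => ?_)
    exact csInf_le hbdd ⟨hx0.trans hz.le, (h'.le_of_lt h hx0 hz).trans hx⟩

end ConcaveDual

/-! ### Limsup averages and the Lagrangian problem -/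

namespace RemoteSystem

variable {M : ℕ} (sys : RemoteSystem M)

lemma exists_meanCost_bound (g : sys.State → sys.Action → sys.State → ℝ) :
    ∃ B : ℝ, ∀ s a, |sys.meanCost g s a| ≤ B := by
  obtain ⟨B, hB⟩ := Finite.bddAbove_range
    (fun x : sys.State × sys.Action => |sys.meanCost g x.1 x.2|)
  exact ⟨B, fun s a => hB ⟨(s, a), rfl⟩⟩

lemma expCost_mem_Icc {g : sys.State → sys.Action → sys.State → ℝ} {a b : ℝ}
    (h : ∀ s x, sys.meanCost g s x ∈ Set.Icc a b) (π : sys.Policy) (s : sys.State) (t : ℕ) :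
    sys.expCost g π s t ∈ Set.Icc a b := by
  constructor
  · rw [← sys.expState_const π s t a]
    exact sys.expCost_mono π s t fun s x => by
      rw [sys.meanCost_of_state (fun _ => a)]; exact (h s x).1
  · conv_rhs => rw [← sys.expState_const π s t b]
    exact sys.expCost_mono π s t fun s x => by
      rw [sys.meanCost_of_state (fun _ => b)]; exact (h s x).2

lemma cesaro_mem_Icc {g : sys.State → sys.Action → sys.State → ℝ} {a b : ℝ}
    (h : ∀ s x, sys.meanCost g s x ∈ Set.Icc a b) (π : sys.Policy) (s : sys.State) {T : ℕ}
    (hT : 0 < T) : sys.cesaro g π s T ∈ Set.Icc a b := by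
  have hT' : (0 : ℝ) < T := by exact_mod_cast hT
  have h1 := Finset.card_nsmul_le_sum (Finset.range T) (fun t => sys.expCost g π s t) a
    fun t _ => (sys.expCost_mem_Icc h π s t).1
  have h2 := Finset.sum_le_card_nsmul (Finset.range T) (fun t => sys.expCost g π s t) b
    fun t _ => (sys.expCost_mem_Icc h π s t).2
  rw [Finset.card_range, nsmul_eq_mul, mul_comm] at h1 h2
  exact ⟨(le_div_iff₀ hT').2 h1, (div_le_iff₀ hT').2 h2⟩

/-- A real `limsup` is informative only for bounded sequences; the limsup estimates below rely on
this. -/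
lemma isBounded_cesaro (g : sys.State → sys.Action → sys.State → ℝ) (π : sys.Policy)
    (s : sys.State) : IsBoundedUnder (· ≤ ·) atTop (sys.cesaro g π s) ∧
      IsBoundedUnder (· ≥ ·) atTop (sys.cesaro g π s) := by
  obtain ⟨B, hB⟩ := sys.exists_meanCost_bound g
  have h : ∀ s x, sys.meanCost g s x ∈ Set.Icc (-B) B := fun s x => abs_le.1 (hB s x)
  constructor
  · refine ⟨B, ?_⟩
    rw [eventually_map]
    filter_upwards [eventually_gt_atTop 0] with T hT using (sys.cesaro_mem_Icc h π s hT).2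
  · refine ⟨-B, ?_⟩
    rw [eventually_map]
    filter_upwards [eventually_gt_atTop 0] with T hT using (sys.cesaro_mem_Icc h π s hT).1

lemma avgCost_le_of_eventually {g : sys.State → sys.Action → sys.State → ℝ} {π : sys.Policy}
    {s : sys.State} {b : ℝ} (h : ∀ᶠ T in atTop, sys.cesaro g π s T ≤ b) :
    sys.avgCost g π s ≤ b :=
  limsup_le_of_le (sys.isBounded_cesaro g π s).2.isCoboundedUnder_le h

lemma le_avgCost_of_eventually {g : sys.State → sys.Action → sys.State → ℝ} {π : sys.Policy}
    {s : sys.State} {a : ℝ} (h : ∀ᶠ T in atTop, a ≤ sys.cesaro g π s T) :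
    a ≤ sys.avgCost g π s :=
  le_limsup_of_frequently_le h.frequently (sys.isBounded_cesaro g π s).1

lemma avgCost_mem_Icc {g : sys.State → sys.Action → sys.State → ℝ} {a b : ℝ}
    (h : ∀ s x, sys.meanCost g s x ∈ Set.Icc a b) (π : sys.Policy) (s : sys.State) :
    sys.avgCost g π s ∈ Set.Icc a b := by
  constructor
  · apply le_avgCost_of_eventually
    filter_upwards [eventually_gt_atTop 0] with T hT using (sys.cesaro_mem_Icc h π s hT).1
  · apply avgCost_le_of_eventually
    filter_upwards [eventually_gt_atTop 0] with T hT using (sys.cesaro_mem_Icc h π s hT).2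

/-- Exact at each horizon, whereas the limsups are in general only subadditive. -/
lemma cesaro_lagCost (lam : ℝ) (π : sys.Policy) (s : sys.State) (T : ℕ) :
    sys.cesaro (sys.lagCost lam) π s T =
      sys.cesaro sys.actCost π s T + lam * sys.cesaro sys.txCost π s T := by
  have h : ∀ t, sys.expCost (sys.lagCost lam) π s t =
      sys.expCost sys.actCost π s t + lam * sys.expCost sys.txCost π s t := fun t => by
    rw [← sys.expCost_const_mul, ← sys.expCost_add]; rfl
  simp only [cesaro, h, Finset.sum_add_distrib, ← Finset.mul_sum]
  ring

lemma meanCost_txCost (s : sys.State) (a : sys.Action) :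
    sys.meanCost sys.txCost s a = if a ≠ none then 1 else 0 := by
  simp [meanCost, txCost, sys.trans_sum]

lemma meanCost_txCost_mem (s : sys.State) (a : sys.Action) :
    sys.meanCost sys.txCost s a ∈ Set.Icc (0 : ℝ) 1 := by
  rw [meanCost_txCost]
  split_ifs <;> simp

lemma cesaro_txCost_silent (s : sys.State) (T : ℕ) :
    sys.cesaro sys.txCost (sys.detPolicy fun _ => none) s T = 0 := by
  have h : ∀ t, sys.expCost sys.txCost (sys.detPolicy fun _ => none) s t = 0 := fun t => by
    rw [expCost_detPolicy]
    simpa [meanCost_txCost] using sys.expState_const _ s t 0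
  simp [cesaro, h]

/-- The Lagrangian problem is solved by a stationary deterministic policy, its value `l` is
independent of the initial state, and `l` bounds the averages of every policy asymptotically
from below. -/
theorem exists_lagrangian_solution (hps : 0 < sys.ps) (hQ : ∀ m, (sys.Q m).IsPrimitive)
    (lam : ℝ) : ∃ (l : ℝ) (μ : sys.State → sys.Action),
      sys.IsLambdaOptimal lam (sys.detPolicy μ) ∧ (∀ s, sys.avgLag lam (sys.detPolicy μ) s = l) ∧
      (∀ π s, l ≤ sys.avgLag lam π s) ∧
      ∀ π s, ∀ ε > 0, ∀ᶠ T in atTop, l - ε ≤ sys.cesaro (sys.lagCost lam) π s T := by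
  obtain ⟨l, w, u, μ, s₀, hw, hu, hreach⟩ := exists_unichain_optimal (P := sys.trans)
    sys.trans_nonneg sys.trans_sum (sys.meanCost (sys.lagCost lam)) (sys.reaches_all hps hQ)
  obtain ⟨C, hC⟩ := sys.exists_le_cesaro hw
  have hlow : ∀ π s, ∀ ε > 0, ∀ᶠ T in atTop, l - ε ≤ sys.cesaro (sys.lagCost lam) π s T := by
    intro π s ε hε
    have hlim := tendsto_const_div_atTop_nhds_zero_nat C
    filter_upwards [hlim.eventually_le_const hε, eventually_gt_atTop 0] with T h1 hT
    linarith [hC π s T hT]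
  have hle : ∀ π s, l ≤ sys.avgLag lam π s := fun π s =>
    le_of_forall_sub_le fun ε hε => sys.le_avgCost_of_eventually (hlow π s ε hε)
  have hL : ∀ s, sys.avgLag lam (sys.detPolicy μ) s = l := fun s =>
    (sys.tendsto_cesaro_detPolicy hu s).limsup_eq
  have hconst : ∀ g, ∃ c : ℝ, ∀ s, sys.avgCost g (sys.detPolicy μ) s = c := by
    intro g
    obtain ⟨c, v, hv⟩ := exists_poisson (fun s x => sys.trans_nonneg s (μ s) x)
      (fun s => sys.trans_sum s (μ s)) hreach (fun s => sys.meanCost g s (μ s))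
    exact ⟨c, fun s => (sys.tendsto_cesaro_detPolicy hv s).limsup_eq⟩
  exact ⟨l, μ, ⟨fun s π => (hL s).trans_le (hle π s), ⟨l, hL⟩, hconst _, hconst _⟩, hL, hle, hlow⟩

end RemoteSystem

theorem proposition4 {M : ℕ} (sys : RemoteSystem M) (hps : 0 < sys.ps)
    (hQ : ∀ m, (sys.Q m).IsPrimitive)
    (Fmax : ℝ) (hF0 : 0 < Fmax) (hF1 : Fmax ≤ 1) :
    (∀ lam : ℝ, 0 ≤ lam →
      ∃ μ : sys.State → sys.Action, sys.IsLambdaOptimal lam (sys.detPolicy μ)) ∧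
    ∃ γ : ℝ, 0 ≤ γ ∧
      (∀ F : ℝ → ℝ, sys.IsOptimalFrequency F → gammaValue F Fmax = (γ : EReal)) ∧
      ∀ s : sys.State, IsMaxOn (sys.outerObjective Fmax s) (Set.Ici 0) γ := by
  choose G μ hopt hval hle hlow using sys.exists_lagrangian_solution hps hQ
  have s₀ : sys.State := fun m => (⟨0, sys.N_pos m⟩, ⟨0, sys.N_pos m⟩)
  have hinf : ∀ lam s, ⨅ π : sys.Policy, sys.avgLag lam π s = G lam := fun lam s =>
    le_antisymm ((ciInf_le ⟨G lam, by rintro _ ⟨π, rfl⟩; exact hle lam π s⟩ _).trans_eq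
      (hval lam s)) (have : Nonempty sys.Policy := ⟨sys.detPolicy (μ 0)⟩
        le_ciInf fun π => hle lam π s)
  have hsuper : ∀ F, sys.IsOptimalFrequency F → IsSupergradient G F := by
    intro F hF x y hx hy
    obtain ⟨π, hπ, hπF⟩ := hF x hx
    rw [← hπF s₀]
    have hπG : sys.avgLag x π s₀ ≤ G x := (hπ.1 s₀ _).trans_eq (hval x s₀)
    -- Test the `x`-optimal policy at `y`: its `x`-averages are eventually below `G x + ε / 2`, its
    -- `y`-averages eventually above `G y - ε / 2`, and they differ by `(y - x)` times the
    -- transmission average.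
    have hev : ∀ ε > 0, ∀ᶠ T in atTop,
        G y - G x - ε ≤ (y - x) * sys.cesaro sys.txCost π s₀ T := by
      intro ε hε
      have h1 : ∀ᶠ T in atTop, sys.cesaro (sys.lagCost x) π s₀ T < G x + ε / 2 :=
        eventually_lt_of_limsup_lt (hπG.trans_lt (by linarith))
          (sys.isBounded_cesaro _ π s₀).1
      filter_upwards [h1, hlow y π s₀ (ε / 2) (half_pos hε)] with T h1 h2
      rw [sys.cesaro_lagCost] at h1 h2
      linarith
    refine le_of_forall_sub_le fun ε hε => ?_
    -- The sign of `y - x` decides whether division bounds the transmission averages from below or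
    -- from above; both bounds pass to the limsup.
    rcases lt_trichotomy x y with hxy | rfl | hxy
    · have hd := sub_pos.2 hxy
      rw [mul_comm, ← div_le_iff₀ hd]
      refine sys.le_avgCost_of_eventually ?_
      filter_upwards [hev ε hε] with T hT
      rwa [div_le_iff₀ hd, mul_comm]
    · linarith
    · have hd := sub_pos.2 hxy
      suffices sys.avgTx π s₀ ≤ (G x - G y + ε) / (x - y) by
        rw [le_div_iff₀ hd] at this; linarith
      refine sys.avgCost_le_of_eventually ?_
      filter_upwards [hev ε hε] with T hT
      rw [le_div_iff₀ hd]
      linarith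
  choose Fo hFo using fun lam => (hopt lam).2.2.2
  have hFopt : sys.IsOptimalFrequency Fo := fun lam _ => ⟨_, hopt lam, hFo lam⟩
  have hFmem : ∀ x, Fo x ∈ Set.Icc (0 : ℝ) 1 := fun x => by
    rw [← hFo x s₀]
    exact sys.avgCost_mem_Icc sys.meanCost_txCost_mem _ _
  have hS := hsuper Fo hFopt
  have hne : {x | 0 ≤ x ∧ Fo x ≤ Fmax}.Nonempty := by
    obtain ⟨B, hB⟩ := sys.exists_meanCost_bound sys.actCost
    have hGB : ∀ x, G x ≤ B := fun x => by
      refine (hle x (sys.detPolicy fun _ => none) s₀).trans (sys.avgCost_le_of_eventually ?_)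
      filter_upwards [eventually_gt_atTop 0] with T hT
      rw [sys.cesaro_lagCost, sys.cesaro_txCost_silent, mul_zero, add_zero]
      exact (sys.cesaro_mem_Icc (fun s x => abs_le.1 (hB s x)) _ _ hT).2
    have hd : 0 ≤ (B - G 0) / Fmax := div_nonneg (sub_nonneg.2 (hGB 0)) hF0.le
    -- At this `x`, `x * Fmax` exceeds `B - G 0`, while the supergradient inequality tested at `0`
    -- gives `x * Fo x ≤ G x - G 0 ≤ B - G 0`.
    refine ⟨(B - G 0) / Fmax + 1, by positivity, ?_⟩
    by_contra! hlt
    have h1 := hS ((B - G 0) / Fmax + 1) 0 (by positivity) le_rfl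
    have h2 := hGB ((B - G 0) / Fmax + 1)
    have h3 := mul_lt_mul_of_pos_left hlt (show 0 < (B - G 0) / Fmax + 1 by positivity)
    have h4 : (B - G 0) / Fmax * Fmax = B - G 0 := div_mul_cancel₀ _ hF0.ne'
    linarith
  refine ⟨fun lam _ => ⟨μ lam, hopt lam⟩, sInf {x | 0 ≤ x ∧ Fo x ≤ Fmax},
    le_csInf hne fun x hx => hx.1,
    fun F hF => gammaValue_eq_of_isSupergradient hS (hsuper F hF) hne, fun s => ?_⟩
  have hobj : sys.outerObjective Fmax s = fun x => G x - x * Fmax := by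
    ext x
    rw [RemoteSystem.outerObjective, hinf]
  rw [hobj]
  exact hS.isMaxOn (B := 1) (fun x _ => abs_le.2 ⟨by linarith [(hFmem x).1], (hFmem x).2⟩) hne
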